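/- All digraphs are finite, without loops and without parallel arcs (two opposite arcs between a pair of vertices are allowed). The size $|A(D)|$ of a digraph $D=(V,A)$ is its number of arcs, and its order is $|V|$. The distance $d(u,v)$ is the number of arcs of a shortest directed path from $u$ to $v$ ($\infty$ if there is none). $D$ is biconnected if $d(u,v)<\infty$ for all $u,v\in V$, and its outradius is $\min_{u\in V}\max_{v\in V}d(u,v)$. For $r\ge 2$ let $D_{2r,r,1}$ be the digraph with vertex set $\{v_1,\dots,v_r\}\cup\{w_1,\dots,w_r\}$ and arc set $$\{v_iv_j : i\ne j,\ i\ge j-1\}\cup\{w_iw_j : i\ne j,\ i\ge j-1\}\cup\{v_iw_1 : 1\le i\le r\}\cup\{w_iv_1 : 1\le i\le r\}.$$ For $n\ge 2r$ and an integer $1\le s\le \frac{n-2r+2}{2}$, let $D_{n,r,s}$ be obtained from $D_{2r,r,1}$ by blowing up $v_1$ into a bidirected clique $K_s$ and $w_1$ into a bidirected clique $K_{n-2r+2-s}$ (each vertex of such a clique inherits the arcs, in both directions, of the vertex it replaces; since $v_1w_1$ and $w_1v_1$ are arcs, all arcs between the two cliques are present). **Theorem.** For every $r\ge 4$ there is a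 number $n_1(r)$ such that for all $n>n_1(r)$ the following hold. 1. $|A(D_{n,r,1})|=(n-(r-1))^2+(r-3)$. 2. For every integer $1\le s\le\frac{n-2r+2}{2}$, the digraph $D_{n,r,s}$ is a biconnected digraph of order $n$ and outradius $r$. 3. Every biconnected digraph $D$ of order $n$ and outradius $r$ satisfies $|A(D)|\le |A(D_{n,r,1})|$, with equality if and only if $D\cong D_{n,r,s}$ for some integer $1\le s\le\frac{n-2r+2}{2}$. -/

import Mathlib

namespace Digraph

variable {V : Type*}

/-- `D` has no loops. Multiple arcs are impossible in `Digraph`, so a loopless `Digraph` is a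
digraph in the usual sense of extremal graph theory (a set of ordered pairs of distinct vertices). -/
def Loopless (D : Digraph V) : Prop := ∀ v, ¬ D.Adj v v

/-- The size of `D`: its number of arcs. -/
noncomputable def size (D : Digraph V) : ℕ := {p : V × V | D.Adj p.1 p.2}.ncard

/-- `D.HasWalk u v k`: there is a directed walk from `u` to `v` with exactly `k` arcs. -/
inductive HasWalk (D : Digraph V) : V → V → ℕ → Prop
  | nil (u : V) : HasWalk D u u 0
  | cons {u v w : V} {k : ℕ} (h : D.Adj u v) (p : HasWalk D v w k) : HasWalk D u w (k + 1)

/-- The distance from `u` to `v`: the least number of arcs of a directed walk (equivalently, of a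
directed path) from `u` to `v`, and `⊤` if there is none. -/
noncomputable def dist (D : Digraph V) (u v : V) : ℕ∞ :=
  ⨅ (k : ℕ) (_ : D.HasWalk u v k), (k : ℕ∞)

/-- The out-eccentricity of `u`: the maximum of the distances from `u` to the vertices. -/
noncomputable def outEcc (D : Digraph V) (u : V) : ℕ∞ := ⨆ v, D.dist u v

/-- The outradius: the minimum of the out-eccentricities of the vertices. -/
noncomputable def outradius (D : Digraph V) : ℕ∞ := ⨅ u, D.outEcc u

/-- `D` is biconnected (strong): all distances are finite. -/
def Biconnected (D : Digraph V) : Prop := ∀ u v, D.dist u v ≠ ⊤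

/-- The simultaneous blow-up of every vertex `v` of `D` by a bidirected clique on `m v` vertices
(a vertex with `m v = 1` is left unchanged). -/
def cliqueBlowUp (D : Digraph V) (m : V → ℕ) : Digraph (Σ v, Fin (m v)) where
  Adj p q := p ≠ q ∧ (p.1 = q.1 ∨ D.Adj p.1 q.1)

end Digraph

/-- The digraph `D_{2r,r,1}` on `v_1, …, v_r` (`Sum.inl`) and `w_1, …, w_r` (`Sum.inr`), the indices
being shifted to start at `0`: arcs `v_i v_j` and `w_i w_j` for `i ≠ j`, `i ≥ j - 1`, and arcs
`v_i w_1` and `w_i v_1` for all `i`. -/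
def baseDigraph (r : ℕ) : Digraph (Fin r ⊕ Fin r) where
  Adj
    | .inl i, .inl j => i ≠ j ∧ (j : ℕ) ≤ i + 1
    | .inr i, .inr j => i ≠ j ∧ (j : ℕ) ≤ i + 1
    | .inl _, .inr j => (j : ℕ) = 0
    | .inr _, .inl j => (j : ℕ) = 0

/-- The sizes of the cliques that replace the vertices of `D_{2r,r,1}` in `D_{n,r,s}`: `s` for `v_1`,
`n - 2r + 2 - s` for `w_1`, and `1` for all other vertices. -/
def blowUpSizes (n r s : ℕ) : Fin r ⊕ Fin r → ℕ
  | .inl i => if (i : ℕ) = 0 then s else 1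
  | .inr i => if (i : ℕ) = 0 then n + 2 - 2 * r - s else 1

/-- The digraph `D_{n,r,s}` (meaningful for `n ≥ 2r` and `1 ≤ s ≤ (n - 2r + 2) / 2`). -/
def extremalDigraph (n r s : ℕ) : Digraph (Σ v, Fin (blowUpSizes n r s v)) :=
  (baseDigraph r).cliqueBlowUp (blowUpSizes n r s)

/-!
Write `d` for the distance in a biconnected digraph `D` of order `n` and outradius `r`, and count
missing arcs instead of arcs. The digraph `D_{n,r,s}` misses
`(2 * r - 3) * (n - 2 * r) + (r - 1) * (3 * r - 2)` arcs, and the claim is that `D` misses at least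
as many, with equality only for these digraphs.

If `D` misses at most `(2 * r - 3) * n` arcs and `n` is large, then all but a small proportion of
the vertices are incident with boundedly many missing arcs, and a positive proportion of these
vertices `b` has cost at most `2 * r - 3`, where the cost of `b` counts the missing arcs that leave
`b` or enter `b` from one of the few bad vertices. By the pigeonhole principle, some set `X` of
such vertices `b` has more elements than the bound just mentioned, and all `b ∈ X` have the same set
of vertices at distance at least `r - 1`. Let `b ∈ X`. A vertex `x` with an arc into `X` has a
vertex `z` with `r ≤ d x z`, hence `r - 1 ≤ d b z`, and the vertices without an arc into
`X` are paid for by the cost of `b`. Under these conditions the neighbourhood of `b` can be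
determined exactly
(`Biconnected.exists_skeleton`). A shortest path `p` from `b` to a farthest vertex has length at
least `r`; a vertex `z` for `p 1` that is not beyond `p` is reached by a second shortest path of
length at least `r - 1` that meets `p` only in `b`; together the two paths cost
`(r - 1) + (r - 2) = 2 * r - 3`, and all other configurations cost more. So `b` and the two paths
form a copy of the vertex set of `D_{2r,r,1}`, and every vertex of `D` is at distance at least `r`
from one of the last vertices of the two paths (`Skeleton`,
`Biconnected.exists_skeleton_of_missing_le`).

The rest is a count for each vertex, valid for every `n` (`Skeleton.missing_le`). The far vertex of
a vertex `x` and the distances from `b` force `x` to miss at least as many out-neighbours on the two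
paths as the corresponding vertex of `D_{n,r,s}`, where the vertices outside the paths correspond to
copies of the first vertex of one of the paths. The only exceptions are vertices with an arc to
`v 2`, which may miss one arc less; but two vertices of the other path then miss the arcs to them.
In the case of equality every vertex misses exactly the arcs prescribed by `D_{2r,r,1}`, so `D` is
a blow-up of it.
-/

namespace Digraph

/-! ### Distances as natural numbers -/

section distances

variable {V : Type*} {D : Digraph V} {u v w : V}

theorem HasWalk.trans {k l : ℕ} (p : D.HasWalk u v k) (q : D.HasWalk v w l) :
    D.HasWalk u w (k + l) := by
  induction p with
  | nil u => simpa using q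
  | @cons a b c k h p ih =>
    have := HasWalk.cons h (ih q)
    rwa [show k + l + 1 = k + 1 + l by omega] at this

theorem HasWalk.single (h : D.Adj u v) : D.HasWalk u v 1 := HasWalk.cons h (HasWalk.nil v)

/-- The distance as a natural number; it is the junk value `0` if there is no walk from `u` to
`v`. -/
noncomputable def ndist (D : Digraph V) (u v : V) : ℕ := sInf {k | D.HasWalk u v k}

theorem HasWalk.ndist_le {k : ℕ} (p : D.HasWalk u v k) : D.ndist u v ≤ k := Nat.sInf_le p

theorem dist_eq_ndist (h : ∃ k, D.HasWalk u v k) : D.dist u v = D.ndist u v := by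
  apply le_antisymm
  · exact iInf₂_le (D.ndist u v) (Nat.sInf_mem h)
  · exact le_iInf₂ fun k hk => by exact_mod_cast hk.ndist_le

theorem biconnected_iff : D.Biconnected ↔ ∀ u v, ∃ k, D.HasWalk u v k := by
  refine forall₂_congr fun u v => ⟨fun h => ?_, fun h => ?_⟩
  · by_contra hne
    push Not at hne
    exact h (by simp [dist, hne])
  · rw [dist_eq_ndist h]
    exact ENat.natCast_ne_top _

theorem Biconnected.hasWalk_ndist (hD : D.Biconnected) (u v : V) :
    D.HasWalk u v (D.ndist u v) := Nat.sInf_mem (biconnected_iff.1 hD u v)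

theorem Biconnected.ndist_triangle (hD : D.Biconnected) (u v w : V) :
    D.ndist u w ≤ D.ndist u v + D.ndist v w :=
  ((hD.hasWalk_ndist u v).trans (hD.hasWalk_ndist v w)).ndist_le

@[simp] theorem ndist_self (D : Digraph V) (u : V) : D.ndist u u = 0 :=
  Nat.le_zero.1 (HasWalk.nil u).ndist_le

theorem ndist_le_one (h : D.Adj u v) : D.ndist u v ≤ 1 := (HasWalk.single h).ndist_le

theorem Biconnected.ndist_eq_zero (hD : D.Biconnected) (h : D.ndist u v = 0) : u = v := by
  have := hD.hasWalk_ndist u v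
  rw [h] at this
  cases this
  rfl

theorem Biconnected.adj_of_ndist_eq_one (hD : D.Biconnected) (h : D.ndist u v = 1) :
    D.Adj u v := by
  have := hD.hasWalk_ndist u v
  rw [h] at this
  cases this with
  | cons h p => cases p; exact h

theorem Biconnected.exists_le_ndist (hD : D.Biconnected) {r : ℕ} (hr : D.outradius = r) (u : V) :
    ∃ v, r ≤ D.ndist u v := by
  by_contra! hlt
  have h0 : 0 < r := (Nat.zero_le _).trans_lt (hlt u)
  have h1 : (r : ℕ∞) ≤ D.outEcc u := hr ▸ iInf_le _ u
  have h2 : D.outEcc u ≤ ((r - 1 : ℕ) : ℕ∞) := by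
    refine iSup_le fun v => ?_
    rw [dist_eq_ndist (biconnected_iff.1 hD u v)]
    have := hlt v
    exact_mod_cast (by omega : D.ndist u v ≤ r - 1)
  have := h1.trans h2
  have : r ≤ r - 1 := by exact_mod_cast this
  omega

/-- A shortest path, given as the sequence of its vertices (constant after its end). -/
theorem Biconnected.exists_geodesic (hD : D.Biconnected) (u v : V) :
    ∃ p : ℕ → V, p 0 = u ∧ p (D.ndist u v) = v ∧ (∀ i < D.ndist u v, D.Adj (p i) (p (i + 1))) ∧
      ∀ i ≤ D.ndist u v, D.ndist u (p i) = i := by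
  have walk : ∀ {k : ℕ} {u v : V}, D.HasWalk u v k →
      ∃ p : ℕ → V, p 0 = u ∧ p k = v ∧ ∀ i < k, D.Adj (p i) (p (i + 1)) := by
    intro k u v h
    induction h with
    | nil u => exact ⟨fun _ => u, rfl, rfl, by simp⟩
    | @cons a b c k h q ih =>
      obtain ⟨p, h0, hk, hp⟩ := ih
      refine ⟨fun i => Nat.casesOn i a p, rfl, hk, fun i hi => ?_⟩
      cases i with
      | zero => simpa [h0] using h
      | succ i => exact hp i (by omega)
  obtain ⟨p, h0, hk, hp⟩ := walk (hD.hasWalk_ndist u v)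
  have seg : ∀ j i, i + j ≤ D.ndist u v → D.HasWalk (p i) (p (i + j)) j := by
    intro j
    induction j with
    | zero => exact fun i _ => HasWalk.nil _
    | succ j ih =>
      intro i hi
      have := HasWalk.cons (hp i (by omega)) (ih (i + 1) (by omega))
      rwa [show i + 1 + j = i + (j + 1) by omega] at this
  refine ⟨p, h0, hk, hp, fun i hi => le_antisymm ?_ ?_⟩
  · have := seg i 0 (by omega)
    rw [h0, zero_add] at this
    exact this.ndist_le
  · have h1 := (seg (D.ndist u v - i) i (by omega)).ndist_le
    rw [show i + (D.ndist u v - i) = D.ndist u v by omega, hk] at h1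
    have := hD.ndist_triangle u (p i) v
    omega

theorem Biconnected.ndist_le_of_chain (hD : D.Biconnected) {p : ℕ → V} {m : ℕ}
    (hp : ∀ i < m, D.Adj (p i) (p (i + 1))) {i j : ℕ} (hij : i ≤ j) (hj : j ≤ m) :
    D.ndist (p i) (p j) ≤ j - i := by
  induction j, hij using Nat.le_induction with
  | base => simp
  | succ j hij ih =>
    have h1 := ih (by omega)
    have h2 := hD.ndist_triangle (p i) (p j) (p (j + 1))
    have h3 := ndist_le_one (hp j (by omega))
    omega

theorem Biconnected.ndist_le_of_adj (hD : D.Biconnected) (h : D.Adj u v) (w : V) :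
    D.ndist u w ≤ D.ndist v w + 1 := by
  have h1 := hD.ndist_triangle u v w
  have h2 := ndist_le_one h
  omega

theorem Biconnected.ndist_adj_le (hD : D.Biconnected) (w : V) (h : D.Adj u v) :
    D.ndist w v ≤ D.ndist w u + 1 := by
  have h1 := hD.ndist_triangle w u v
  have h2 := ndist_le_one h
  omega

end distances

/-! ### Missing arcs -/

section missingArcs

variable {V : Type*} {D : Digraph V} [Fintype V]

open Classical in
/-- The vertices other than `x` that are not out-neighbours of `x`. -/
noncomputable def outMiss (D : Digraph V) (x : V) : Finset V :=
  Finset.univ.filter fun y => x ≠ y ∧ ¬ D.Adj x y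

open Classical in
/-- The vertices other than `x` that are not in-neighbours of `x`. -/
noncomputable def inMiss (D : Digraph V) (x : V) : Finset V :=
  Finset.univ.filter fun y => y ≠ x ∧ ¬ D.Adj y x

/-- The number of missing arcs. -/
noncomputable def missing (D : Digraph V) : ℕ := ∑ x, (D.outMiss x).card

@[simp] theorem mem_outMiss {x y : V} : y ∈ D.outMiss x ↔ x ≠ y ∧ ¬ D.Adj x y := by
  simp [outMiss]

@[simp] theorem mem_inMiss {x y : V} : y ∈ D.inMiss x ↔ y ≠ x ∧ ¬ D.Adj y x := by
  simp [inMiss]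

theorem Biconnected.mem_outMiss_iff (hD : D.Biconnected) {x y : V} :
    y ∈ D.outMiss x ↔ 2 ≤ D.ndist x y := by
  rw [mem_outMiss]
  constructor
  · rintro ⟨h1, h2⟩
    by_contra! h
    interval_cases h3 : D.ndist x y
    · exact h1 (hD.ndist_eq_zero h3)
    · exact h2 (hD.adj_of_ndist_eq_one h3)
  · refine fun h => ⟨?_, fun h2 => ?_⟩
    · rintro rfl
      simp at h
    · have := ndist_le_one h2
      omega

/-- The number of missing arcs, counted by their tails and by their heads. -/
theorem sum_card_inMiss (D : Digraph V) : ∑ x, (D.inMiss x).card = D.missing := by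
  classical
  simp only [missing, outMiss, inMiss, Finset.card_filter]
  rw [Finset.sum_comm]

theorem size_add_missing (hl : D.Loopless) :
    D.size + D.missing = Fintype.card V * (Fintype.card V - 1) := by
  classical
  have h1 : D.size = ∑ x, (Finset.univ.filter fun y => D.Adj x y).card := by
    rw [size, Set.ncard_eq_toFinset_card', ← Finset.card_sigma]
    refine Finset.card_nbij' (fun p => ⟨p.1, p.2⟩) (fun p => (p.1, p.2)) ?_ ?_ ?_ ?_ <;>
      simp [Set.MapsTo, Set.LeftInvOn]
  rw [h1, missing, ← Finset.sum_add_distrib, ← smul_eq_mul, ← Finset.card_univ,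
    ← Finset.sum_const]
  refine Finset.sum_congr rfl fun x _ => ?_
  rw [← Finset.card_erase_of_mem (Finset.mem_univ x), ← Finset.card_union_of_disjoint]
  · congr 1
    ext y
    by_cases h : x = y
    · subst h
      simp [hl x]
    · simp [h, Ne.symm h, em]
  · rw [Finset.disjoint_left]
    intro y hy hy'
    simp at hy hy'
    exact hy'.2 hy

/-! ### The structure of a cheapest vertex -/

/-- `D.Skeleton r v w` describes the neighbourhood of `b = v 0` that is met in `D_{n,r,s}`: two
shortest paths `v 0, v 1, …, v (r - 1)` and `v 0, w 0, …, w (r - 1)` that share only their first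
vertex and contain all vertices at distance at least `2` from `v 0`, such that every vertex is at
distance at least `r` from one of the last vertices of the two paths. -/
structure Skeleton (D : Digraph V) (r : ℕ) (v w : ℕ → V) : Prop where
  level_v : ∀ i < r, D.ndist (v 0) (v i) = i
  level_w : ∀ i < r, D.ndist (v 0) (w i) = i + 1
  adj_v : ∀ i < r - 1, D.Adj (v i) (v (i + 1))
  adj_w : ∀ i < r - 1, D.Adj (w i) (w (i + 1))
  ne : ∀ i < r, ∀ j < r, v i ≠ w j
  cover : ∀ x, 2 ≤ D.ndist (v 0) x → (∃ i < r, x = v i) ∨ ∃ i < r, x = w i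
  far_w : r ≤ D.ndist (w 0) (v (r - 1))
  far : ∀ u, r ≤ D.ndist u (v (r - 1)) ∨ r ≤ D.ndist u (w (r - 2)) ∨ r ≤ D.ndist u (w (r - 1))

/-- The counting argument around one vertex `b`. Let `p` be a shortest path from `b` to a farthest
vertex. A vertex `p i` outside `N` needs a vertex `z` far from both `p i` and `b`; either `z` makes
`p` long, or a shortest path `q` from `b` to `z` avoids `p` from its `i`-th vertex on. Both cost
missing arcs at `b`, as do the elements of `N`, and the cheapest possibility is that `p 1 ∉ N`
and `q` avoids `p` altogether. -/
theorem Biconnected.exists_skeleton (hD : D.Biconnected) {r : ℕ} (hr : 3 ≤ r) (b : V)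
    (N : Finset V) (hbN : b ∉ N) (hN : ∀ x ∉ N, ∃ z, r ≤ D.ndist x z ∧ r ≤ D.ndist b z + 1)
    (hcard : (D.outMiss b).card + N.card ≤ 2 * r - 3) :
    ∃ v w : ℕ → V, v 0 = b ∧ D.Skeleton r v w := by
  classical
  obtain ⟨z₀, -, hz₀⟩ := Finset.exists_max_image Finset.univ (D.ndist b) ⟨b, Finset.mem_univ b⟩
  obtain ⟨p, hp0, hpm, hpa, hpl⟩ := hD.exists_geodesic b z₀
  set m := D.ndist b z₀ with hm
  have hmax : ∀ z, D.ndist b z ≤ m := fun z => hz₀ z (Finset.mem_univ z)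
  have hrm : r ≤ m := by
    obtain ⟨z, hz, -⟩ := hN b hbN
    exact hz.trans (hmax z)
  have hinj : Set.InjOn p (Set.Iic m) := by
    intro i hi j hj hij
    rw [← hpl i hi, ← hpl j hj, hij]
  -- the least index beyond `m - r` of a vertex of `p` outside `N`
  have hex : ∃ i, m - r < i ∧ i ≤ m ∧ p i ∉ N := by
    by_contra! hall
    have h1 : (Finset.Ioc (m - r) m).image p ⊆ N := by
      intro x hx
      obtain ⟨i, hi, rfl⟩ := Finset.mem_image.1 hx
      rw [Finset.mem_Ioc] at hi
      exact hall i hi.1 hi.2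
    have h2 : (Finset.Icc 2 m).image p ⊆ D.outMiss b := by
      intro x hx
      obtain ⟨i, hi, rfl⟩ := Finset.mem_image.1 hx
      rw [Finset.mem_Icc] at hi
      rw [hD.mem_outMiss_iff, hpl i hi.2]
      exact hi.1
    have h3 := Finset.card_le_card h1
    have h4 := Finset.card_le_card h2
    rw [Finset.card_image_of_injOn (hinj.mono fun i hi => (Finset.mem_Ioc.1 hi).2),
      Nat.card_Ioc] at h3
    rw [Finset.card_image_of_injOn (hinj.mono fun i hi => (Finset.mem_Icc.1 hi).2),
      Nat.card_Icc] at h4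
    omega
  let i := Nat.find hex
  obtain ⟨hi1, hi2, hi3⟩ : m - r < i ∧ i ≤ m ∧ p i ∉ N := Nat.find_spec hex
  have himin : ∀ j, m - r < j → j < i → p j ∈ N := by
    intro j h1 h2
    by_contra h3
    exact Nat.find_min hex h2 ⟨h1, by omega, h3⟩
  obtain ⟨z, hz1, hz2⟩ := hN _ hi3
  obtain ⟨q, hq0, hql, hqa, hqd⟩ := hD.exists_geodesic b z
  set l := D.ndist b z with hl
  have hlm : l ≤ m := hmax z
  have hqinj : Set.InjOn q (Set.Iic l) := by
    intro i hi j hj hij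
    rw [← hqd i hi, ← hqd j hj, hij]
  -- as `l ≤ m < r + i`, the path `q` cannot meet `p` after `p i`
  have hdisj : ∀ k, i ≤ k → k ≤ l → q k ≠ p k := by
    intro k h1 h2 h3
    have h4 := hD.ndist_le_of_chain hpa h1 (h2.trans hlm)
    have h5 := hD.ndist_le_of_chain hqa h2 le_rfl
    have h6 := hD.ndist_triangle (p i) (p k) z
    rw [hql, h3] at h5
    omega
  have hpq : ∀ j ≤ m, ∀ k, i ≤ k → k ≤ l → p j ≠ q k := by
    intro j hj k h1 h2 h3
    have h4 : j = k := by rw [← hpl j hj, ← hqd k h2, h3]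
    subst h4
    exact hdisj j h1 h2 h3.symm
  let P := (Finset.Icc 2 m).image p
  let Q := (Finset.Icc (max i 2) l).image q
  have hPc : P.card = m - 1 := by
    rw [Finset.card_image_of_injOn (hinj.mono fun i hi => (Finset.mem_Icc.1 hi).2), Nat.card_Icc]
    omega
  have hQc : Q.card = l + 1 - max i 2 := by
    rw [Finset.card_image_of_injOn (hqinj.mono fun i hi => (Finset.mem_Icc.1 hi).2), Nat.card_Icc]
  have hPQ : Disjoint P Q := by
    rw [Finset.disjoint_left]
    intro x hx hy
    obtain ⟨j, hj, rfl⟩ := Finset.mem_image.1 hx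
    obtain ⟨k, hk, hjk⟩ := Finset.mem_image.1 hy
    rw [Finset.mem_Icc] at hj hk
    exact hpq j hj.2 k (by omega) hk.2 hjk.symm
  have hsub : P ∪ Q ⊆ D.outMiss b := by
    intro x hx
    rw [hD.mem_outMiss_iff]
    rcases Finset.mem_union.1 hx with hx | hx <;> obtain ⟨j, hj, rfl⟩ := Finset.mem_image.1 hx <;>
      rw [Finset.mem_Icc] at hj
    · rw [hpl j hj.2]; omega
    · rw [hqd j hj.2]; omega
  have hcardPQ := Finset.card_le_card hsub
  rw [Finset.card_union_of_disjoint hPQ, hPc, hQc] at hcardPQ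
  have hNc : i - 1 - (m - r) ≤ N.card := by
    have h1 : (Finset.Ioo (m - r) i).image p ⊆ N := by
      intro x hx
      obtain ⟨j, hj, rfl⟩ := Finset.mem_image.1 hx
      rw [Finset.mem_Ioo] at hj
      exact himin j hj.1 hj.2
    have h2 := Finset.card_le_card h1
    rw [Finset.card_image_of_injOn (hinj.mono fun j hj => by
      have := (Finset.mem_Ioo.1 hj).2
      exact (this.le.trans hi2)), Nat.card_Ioo] at h2
    omega
  have hi : i = 1 := by omega
  have hmr : m = r := by omega
  have hlr : l = r - 1 := by omega
  have hN0 : N = ∅ := Finset.card_eq_zero.1 (by omega)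
  have hout : D.outMiss b = P ∪ Q := by
    refine (Finset.eq_of_subset_of_card_le hsub ?_).symm
    rw [Finset.card_union_of_disjoint hPQ, hPc, hQc]
    omega
  have hcover : ∀ x, 2 ≤ D.ndist b x → (∃ j < r, x = q j) ∨ ∃ j < r, x = p (j + 1) := by
    intro x hx
    rw [← hD.mem_outMiss_iff, hout] at hx
    rcases Finset.mem_union.1 hx with hx | hx <;> obtain ⟨j, hj, rfl⟩ := Finset.mem_image.1 hx <;>
      rw [Finset.mem_Icc] at hj
    · exact Or.inr ⟨j - 1, by omega, by congr 1; omega⟩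
    · exact Or.inl ⟨j, by omega, rfl⟩
  refine ⟨q, fun j => p (j + 1), hq0, ?_, ?_, ?_, ?_, ?_, ?_, ?_, ?_⟩
  · rw [hq0]
    exact fun j hj => hqd j (by omega)
  · rw [hq0]
    exact fun j hj => hpl (j + 1) (by omega)
  · exact fun j hj => hqa j (by omega)
  · exact fun j hj => hpa (j + 1) (by omega)
  · intro j hj k hk
    rcases Nat.eq_zero_or_pos j with rfl | h0
    · rw [hq0, ← hp0]
      intro h
      have := hinj (show 0 ≤ m by omega) (show k + 1 ≤ m by omega) h
      omega
    · exact (hpq (k + 1) (by omega) j (by omega) (by omega)).symm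
  · rwa [hq0]
  · rw [hi] at hz1
    rw [← hlr, hql]
    exact hz1
  · intro u
    obtain ⟨y, hy1, hy2⟩ := hN u (by simp [hN0])
    rcases hcover y (by omega) with ⟨j, hj, rfl⟩ | ⟨j, hj, rfl⟩
    · rw [hqd j (by omega)] at hy2
      obtain rfl : j = r - 1 := by omega
      exact Or.inl hy1
    · rw [hpl (j + 1) (by omega)] at hy2
      rcases (by omega : j = r - 1 ∨ j = r - 2) with rfl | rfl
      · exact Or.inr (Or.inr hy1)
      · exact Or.inr (Or.inl hy1)

end missingArcs

/-! ### Almost complete digraphs -/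

section almostComplete

variable {V : Type*} {D : Digraph V} [Fintype V]

/-- The vertices incident with more than `K` missing arcs. -/
noncomputable def badSet (D : Digraph V) (K : ℕ) : Finset V :=
  Finset.univ.filter fun x => K < (D.outMiss x).card + (D.inMiss x).card

theorem card_badSet_mul_le (D : Digraph V) (K : ℕ) :
    (D.badSet K).card * (K + 1) ≤ 2 * D.missing := by
  have h1 : ∑ x, ((D.outMiss x).card + (D.inMiss x).card) = 2 * D.missing := by
    rw [Finset.sum_add_distrib, sum_card_inMiss, missing]
    ring
  rw [← h1, ← smul_eq_mul]
  refine le_trans (Finset.card_nsmul_le_sum _ _ _ fun x hx => ?_)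
    (Finset.sum_le_sum_of_subset (Finset.subset_univ (D.badSet K)))
  exact (Finset.mem_filter.1 hx).2

/-- The left side counts the missing arcs that are not inside `B`: those with the tail outside `B`
at their tail, the others at their head. -/
theorem sum_compl_le_missing [DecidableEq V] (D : Digraph V) (B : Finset V) :
    ∑ b ∈ Bᶜ, ((D.outMiss b).card + (D.inMiss b ∩ B).card) ≤ D.missing := by
  have h1 : ∑ b ∈ Bᶜ, (D.inMiss b ∩ B).card ≤ ∑ x ∈ B, (D.outMiss x).card := by
    have h2 : ∀ b, (D.inMiss b ∩ B).card = ∑ x ∈ B, if b ∈ D.outMiss x then 1 else 0 := by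
      intro b
      rw [← Finset.card_filter]
      congr 1
      ext x
      simp [and_comm]
    have h3 : ∀ x, (D.outMiss x).card = ∑ b, if b ∈ D.outMiss x then 1 else 0 := by
      intro x
      rw [← Finset.card_filter]
      simp
    simp only [h2, h3]
    rw [Finset.sum_comm]
    exact Finset.sum_le_sum fun x _ => Finset.sum_le_sum_of_subset (Finset.subset_univ _)
  rw [Finset.sum_add_distrib, missing, ← Finset.sum_compl_add_sum B]
  omega

/-- A digraph of large order `n` with outradius at least `r` and at most `(2 * r - 3) * n` missing
arcs contains a vertex with the neighbourhood described by `Skeleton`: many vertices satisfy the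
cost bound of `Biconnected.exists_skeleton`, and among these many have the same set of vertices at
distance at least `r - 1`. So almost every vertex has an arc to one of these, which provides the
far vertices that `Biconnected.exists_skeleton` asks for. The value of `K` makes the number of bad
vertices at most `n / (2 * (t + 1))`; there are at most `2 ^ t` possible sets of vertices at
distance at least `r - 1`. -/
theorem Biconnected.exists_skeleton_of_missing_le (hD : D.Biconnected) {r t K : ℕ} (hr : 4 ≤ r)
    (ht : t = 2 * r - 3) (hK : K + 1 = 4 * (t + 1) * t)
    (hfar : ∀ u, ∃ v, r ≤ D.ndist u v) (hM : D.missing ≤ t * Fintype.card V)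
    (hn : 2 * (t + 1) * (2 ^ t * (K + 1)) < Fintype.card V) :
    ∃ v w : ℕ → V, D.Skeleton r v w := by
  classical
  set n := Fintype.card V with hn'
  have ht0 : 0 < t := by omega
  have hpow : 1 ≤ 2 ^ t := Nat.one_le_two_pow
  set B := D.badSet K with hB
  have hgood : ∀ b, b ∉ B ↔ (D.outMiss b).card + (D.inMiss b).card ≤ K := by
    intro b
    simp [hB, badSet]
  have hBc : 2 * (t + 1) * B.card ≤ n := by
    have h1 := (D.card_badSet_mul_le K).trans (Nat.mul_le_mul_left 2 hM)
    rw [hK] at h1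
    have h2 : (2 * t) * (2 * (t + 1) * B.card) ≤ (2 * t) * n := by
      calc _ = B.card * (4 * (t + 1) * t) := by ring
        _ ≤ _ := h1
        _ = _ := by ring
    exact Nat.le_of_mul_le_mul_left h2 (by omega)
  set A := Bᶜ.filter fun b => (D.outMiss b).card + (D.inMiss b ∩ B).card ≤ t with hA
  have hAc : 2 ^ t * (K + 1) < A.card := by
    by_contra! hle
    have h1 : (t + 1) * (Bᶜ \ A).card ≤ D.missing := by
      refine le_trans ?_ (D.sum_compl_le_missing B)
      rw [mul_comm, ← smul_eq_mul]
      refine le_trans (Finset.card_nsmul_le_sum _ _ _ fun x hx => ?_)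
        (Finset.sum_le_sum_of_subset (Finset.sdiff_subset (t := A)))
      rw [Finset.mem_sdiff, hA, Finset.mem_filter] at hx
      by_contra! h
      exact hx.2 ⟨hx.1, by omega⟩
    have h2 := Finset.le_card_sdiff A Bᶜ
    rw [Finset.card_compl] at h2
    have h3 : n ≤ (Bᶜ \ A).card + B.card + 2 ^ t * (K + 1) := by omega
    have h4 := Nat.mul_le_mul_left (2 * (t + 1)) h3
    nlinarith
  -- vertices at distance at least `3` from some vertex outside `B` have almost no in-neighbours
  set Q := Finset.univ.filter fun y => ∃ b ∉ B, 3 ≤ D.ndist b y with hQ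
  have hQc : Q.card ≤ t := by
    by_contra! hlt
    have h1 : Q.card * (n - K) ≤ D.missing := by
      rw [← sum_card_inMiss, ← smul_eq_mul]
      refine le_trans (Finset.card_nsmul_le_sum _ _ _ fun y hy => ?_)
        (Finset.sum_le_sum_of_subset (Finset.subset_univ Q))
      obtain ⟨b, hb, hby⟩ := (Finset.mem_filter.1 hy).2
      have h2 : (D.outMiss b)ᶜ ⊆ D.inMiss y := by
        intro c hc
        rw [Finset.mem_compl, hD.mem_outMiss_iff] at hc
        rw [mem_inMiss]
        refine ⟨?_, fun h => ?_⟩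
        · rintro rfl
          omega
        · have := hD.ndist_adj_le b h
          omega
      have h3 := Finset.card_le_card h2
      rw [Finset.card_compl] at h3
      have := (hgood b).1 hb
      omega
    have h2 : (t + 1) * (n - K) ≤ t * n := (Nat.mul_le_mul_right _ hlt).trans (h1.trans hM)
    have hKn : (t + 1) * (K + 1) < n := by
      refine lt_of_le_of_lt ?_ hn
      nlinarith [Nat.mul_le_mul_right (K + 1) hpow]
    have h4 : K ≤ n := by nlinarith
    zify [h4] at h2 hKn
    nlinarith
  set F : V → Finset V := fun b => Finset.univ.filter fun z => r ≤ D.ndist b z + 1 with hF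
  have hFQ : ∀ b ∈ A, F b ∈ Q.powerset := by
    intro b hb
    rw [Finset.mem_powerset]
    intro z hz
    have h1 := (Finset.mem_filter.1 hz).2
    refine Finset.mem_filter.2 ⟨Finset.mem_univ z, b, ?_, by omega⟩
    exact Finset.mem_compl.1 (Finset.mem_filter.1 hb).1
  obtain ⟨F₀, -, hX⟩ := Finset.exists_lt_card_fiber_of_mul_lt_card_of_maps_to hFQ
    (n := K + 1) (lt_of_le_of_lt (Nat.mul_le_mul_right _ (by
      rw [Finset.card_powerset]
      exact Nat.pow_le_pow_right (by norm_num) hQc)) hAc)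
  set X := A.filter fun b => F b = F₀ with hXdef
  obtain ⟨b, hbX⟩ : X.Nonempty := Finset.card_pos.1 (by omega)
  obtain ⟨hbA, hbF⟩ := Finset.mem_filter.1 hbX
  obtain ⟨hbB, hbc⟩ := Finset.mem_filter.1 hbA
  -- vertices outside `B` have fewer than `#X - 1` missing arcs
  have hret : ∀ x ∉ B, ∃ y ∈ X, D.Adj x y := by
    intro x hx
    by_contra! hno
    have h1 : X.erase x ⊆ D.outMiss x := by
      intro y hy
      rw [Finset.mem_erase] at hy
      exact mem_outMiss.2 ⟨hy.1.symm, hno y hy.2⟩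
    have h2 := Finset.card_le_card h1
    have h3 := Finset.pred_card_le_card_erase (s := X) (a := x)
    have h4 := (hgood x).1 hx
    omega
  let N : Finset V := Finset.univ.filter fun x => ¬ ∃ y ∈ X, D.Adj x y
  have hbN : b ∉ N := by
    simpa [N] using hret b (Finset.mem_compl.1 hbB)
  suffices h : ∃ v w : ℕ → V, v 0 = b ∧ D.Skeleton r v w from
    let ⟨v, w, _, h⟩ := h
    ⟨v, w, h⟩
  refine hD.exists_skeleton (by omega) b N hbN ?_ ?_
  · intro x hx
    obtain ⟨y, hy, hxy⟩ : ∃ y ∈ X, D.Adj x y := by simpa [N] using hx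
    obtain ⟨z, hz⟩ := hfar x
    have h1 := hD.ndist_le_of_adj hxy z
    have h2 : z ∈ F y := Finset.mem_filter.2 ⟨Finset.mem_univ z, by omega⟩
    rw [(Finset.mem_filter.1 hy).2, ← hbF] at h2
    exact ⟨z, hz, (Finset.mem_filter.1 h2).2⟩
  · have h1 : N ⊆ D.inMiss b ∩ B := by
      intro x hx
      have hx' : ¬ ∃ y ∈ X, D.Adj x y := (Finset.mem_filter.1 hx).2
      rw [Finset.mem_inter, mem_inMiss]
      refine ⟨⟨?_, fun h => hx' ⟨b, hbX, h⟩⟩, ?_⟩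
      · rintro rfl
        exact hbN hx
      · by_contra h
        exact hx' (hret x h)
    have h2 := Finset.card_le_card h1
    omega

end almostComplete

/-! ### The digraphs `D_{n,r,s}` -/

section base

variable {r : ℕ}

theorem baseDigraph_adj_swap (x y : Fin r ⊕ Fin r) :
    (baseDigraph r).Adj x.swap y.swap ↔ (baseDigraph r).Adj x y := by
  rcases x with i | i <;> rcases y with j | j <;> simp [baseDigraph]

theorem inl_mem_outMiss_inl {i j : Fin r} :
    Sum.inl j ∈ (baseDigraph r).outMiss (Sum.inl i) ↔ (i : ℕ) + 2 ≤ j := by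
  simp [baseDigraph, Fin.ext_iff]
  omega

theorem inr_mem_outMiss_inl {i j : Fin r} :
    Sum.inr j ∈ (baseDigraph r).outMiss (Sum.inl i) ↔ 1 ≤ (j : ℕ) := by
  simp [baseDigraph]
  omega

theorem inr_mem_outMiss_inr {i j : Fin r} :
    Sum.inr j ∈ (baseDigraph r).outMiss (Sum.inr i) ↔ (i : ℕ) + 2 ≤ j := by
  simp [baseDigraph, Fin.ext_iff]
  omega

theorem inl_mem_outMiss_inr {i j : Fin r} :
    Sum.inl j ∈ (baseDigraph r).outMiss (Sum.inr i) ↔ 1 ≤ (j : ℕ) := by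
  simp [baseDigraph]
  omega

/-- The index of a vertex of `D_{2r,r,1}` within its path, starting at `0`. -/
def pathIndex : Fin r ⊕ Fin r → ℕ := Sum.elim (fun i => i) (fun i => i)

theorem pathIndex_pos_of_mem_outMiss {x y : Fin r ⊕ Fin r}
    (h : y ∈ (baseDigraph r).outMiss x) : 0 < pathIndex y := by
  rcases x with i | i <;> rcases y with j | j <;>
    simp only [inl_mem_outMiss_inl, inr_mem_outMiss_inl, inl_mem_outMiss_inr,
      inr_mem_outMiss_inr] at h <;> simp [pathIndex] <;> omega

theorem card_fin_filter_le (r a : ℕ) :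
    (Finset.univ.filter fun i : Fin r => a ≤ (i : ℕ)).card = r - a := by
  rw [← Nat.card_Ico, ← Finset.card_map Fin.valEmbedding]
  congr 1
  ext j
  simp only [Finset.mem_map, Finset.mem_filter, Finset.mem_univ, true_and, Fin.valEmbedding_apply,
    Finset.mem_Ico]
  exact ⟨fun ⟨i, h, hi⟩ => hi ▸ ⟨h, i.2⟩, fun h => ⟨⟨j, h.2⟩, h.1, rfl⟩⟩

theorem card_outMiss_baseDigraph (x : Fin r ⊕ Fin r) :
    ((baseDigraph r).outMiss x).card = (r - 1) + (r - (pathIndex x + 2)) := by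
  rcases x with i | i
  · have : (baseDigraph r).outMiss (Sum.inl i) =
        (Finset.univ.filter fun j : Fin r => (i : ℕ) + 2 ≤ (j : ℕ)).disjSum
          (Finset.univ.filter fun j : Fin r => 1 ≤ (j : ℕ)) := by
      ext (j | j)
      · simp [inl_mem_outMiss_inl, -mem_outMiss]
      · simp [inr_mem_outMiss_inl, -mem_outMiss]
    rw [this, Finset.card_disjSum, card_fin_filter_le, card_fin_filter_le, add_comm]
    rfl
  · have : (baseDigraph r).outMiss (Sum.inr i) =
        (Finset.univ.filter fun j : Fin r => 1 ≤ (j : ℕ)).disjSum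
          (Finset.univ.filter fun j : Fin r => (i : ℕ) + 2 ≤ (j : ℕ)) := by
      ext (j | j)
      · simp [inl_mem_outMiss_inr, -mem_outMiss]
      · simp [inr_mem_outMiss_inr, -mem_outMiss]
    rw [this, Finset.card_disjSum, card_fin_filter_le, card_fin_filter_le]
    rfl

theorem two_mul_sum_range_sub (r : ℕ) (hr : 2 ≤ r) :
    2 * ∑ k ∈ Finset.range r, (r - (k + 2)) = (r - 1) * (r - 2) := by
  obtain ⟨q, rfl⟩ := Nat.exists_eq_add_of_le' hr
  rw [Finset.sum_range_succ]
  have h := Finset.sum_range_reflect (fun k => k) (q + 1)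
  have h2 : ∑ k ∈ Finset.range (q + 1), (q + 2 - (k + 2)) = ∑ k ∈ Finset.range (q + 1), k := by
    rw [← h]
    exact Finset.sum_congr rfl fun k _ => by omega
  rw [h2, show q + 2 - (q + 1 + 2) = 0 by omega, add_zero, mul_comm, Finset.sum_range_id_mul_two]
  rfl

theorem missing_baseDigraph (hr : 2 ≤ r) : (baseDigraph r).missing = (r - 1) * (3 * r - 2) := by
  rw [missing]
  simp only [card_outMiss_baseDigraph, Fintype.sum_sum_type, pathIndex, Sum.elim_inl,
    Sum.elim_inr]
  rw [Fin.sum_univ_eq_sum_range (fun k => r - 1 + (r - (k + 2))), ← two_mul,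
    Finset.sum_add_distrib, mul_add, two_mul_sum_range_sub r hr]
  obtain ⟨q, rfl⟩ := Nat.exists_eq_add_of_le' hr
  simp only [Finset.sum_const, Finset.card_range, smul_eq_mul,
    show q + 2 - 1 = q + 1 by omega, show q + 2 - 2 = q by omega,
    show 3 * (q + 2) - 2 = 3 * q + 4 by omega]
  ring

theorem sum_eq_of_eq_one (hr : 0 < r) (f : Fin r ⊕ Fin r → ℕ)
    (hf : ∀ x, 0 < pathIndex x → f x = 1) :
    ∑ x, f x = f (Sum.inl ⟨0, hr⟩) + f (Sum.inr ⟨0, hr⟩) + 2 * (r - 1) := by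
  obtain ⟨q, rfl⟩ := Nat.exists_eq_add_of_le' hr
  rw [Fintype.sum_sum_type, Fin.sum_univ_succ, Fin.sum_univ_succ,
    Finset.sum_congr rfl fun i _ => hf (Sum.inl (Fin.succ i)) (by simp [pathIndex]),
    Finset.sum_congr rfl fun i _ => hf (Sum.inr (Fin.succ i)) (by simp [pathIndex])]
  simp
  ring

end base

section extremal

variable {n r s : ℕ}

theorem blowUpSizes_eq_one {x : Fin r ⊕ Fin r} (hx : 0 < pathIndex x) :
    blowUpSizes n r s x = 1 := by
  rcases x with i | i <;> simp only [pathIndex, Sum.elim_inl, Sum.elim_inr] at hx <;>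
    simp [blowUpSizes, hx.ne']

theorem blowUpSizes_pos (hs : 1 ≤ s) (hs' : s + 2 * r ≤ n + 1) (x : Fin r ⊕ Fin r) :
    0 < blowUpSizes n r s x := by
  rcases x with i | i <;> simp only [blowUpSizes] <;> split_ifs <;> omega

theorem card_extremalDigraph (hr : 0 < r) (hs' : s + 2 * r ≤ n + 1) :
    Fintype.card (Σ v, Fin (blowUpSizes n r s v)) = n := by
  rw [Fintype.card_sigma]
  simp only [Fintype.card_fin]
  rw [sum_eq_of_eq_one hr _ fun x hx => blowUpSizes_eq_one hx]
  simp [blowUpSizes]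
  omega

theorem loopless_extremalDigraph : (extremalDigraph n r s).Loopless := fun _ h => h.1 rfl

theorem card_outMiss_extremalDigraph (p : Σ v, Fin (blowUpSizes n r s v)) :
    ((extremalDigraph n r s).outMiss p).card = ((baseDigraph r).outMiss p.1).card := by
  have h : (extremalDigraph n r s).outMiss p =
      ((baseDigraph r).outMiss p.1).sigma fun _ => Finset.univ := by
    ext q
    simp only [mem_outMiss, Finset.mem_sigma, Finset.mem_univ, and_true, extremalDigraph,
      cliqueBlowUp]
    constructor
    · rintro ⟨h1, h2⟩
      exact ⟨fun h => h2 ⟨h1, Or.inl h⟩, fun h => h2 ⟨h1, Or.inr h⟩⟩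
    · rintro ⟨h1, h2⟩
      exact ⟨fun h => h1 (h ▸ rfl), fun h => h.2.elim h1 h2⟩
  rw [h, Finset.card_sigma, Finset.card_eq_sum_ones]
  refine Finset.sum_congr rfl fun x hx => ?_
  rw [Finset.card_univ, Fintype.card_fin, blowUpSizes_eq_one (pathIndex_pos_of_mem_outMiss hx)]

/-- If all vertices but the first ones of the two paths have weight `1`, then the weighted number of
missing arcs of `D_{2r,r,1}` depends on the total weight only. -/
theorem sum_mul_card_outMiss (hr : 2 ≤ r) (f : Fin r ⊕ Fin r → ℕ)
    (hf : ∀ x, 0 < pathIndex x → f x = 1) (hf' : ∀ x, 1 ≤ f x) :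
    ∑ x, f x * ((baseDigraph r).outMiss x).card =
      (2 * r - 3) * (∑ x, f x - 2 * r) + (r - 1) * (3 * r - 2) := by
  have h1 : ∀ x, f x * ((baseDigraph r).outMiss x).card =
      (2 * r - 3) * (f x - 1) + ((baseDigraph r).outMiss x).card := by
    intro x
    rcases Nat.eq_zero_or_pos (pathIndex x) with h | h
    · rw [card_outMiss_baseDigraph, h, show r - 1 + (r - (0 + 2)) = 2 * r - 3 by omega]
      obtain ⟨k, hk⟩ := Nat.exists_eq_add_of_le' (hf' x)
      rw [hk, Nat.add_sub_cancel]
      ring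
    · simp [hf x h]
  have h2 : ∑ x, (f x - 1) = ∑ x, f x - 2 * r := by
    have h3 : ∑ x, f x = ∑ x, ((f x - 1) + 1) :=
      Finset.sum_congr rfl fun x _ => by have := hf' x; omega
    simp only [Finset.sum_add_distrib, Finset.sum_const, Finset.card_univ, Fintype.card_sum,
      Fintype.card_fin, smul_eq_mul, mul_one] at h3
    omega
  rw [Finset.sum_congr rfl fun x _ => h1 x, Finset.sum_add_distrib, ← Finset.mul_sum, h2,
    ← missing_baseDigraph hr, missing]

theorem missing_extremalDigraph (hr : 2 ≤ r) (hs : 1 ≤ s) (hs' : s + 2 * r ≤ n + 1) :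
    (extremalDigraph n r s).missing = (2 * r - 3) * (n - 2 * r) + (r - 1) * (3 * r - 2) := by
  have h1 : ∑ x, blowUpSizes n r s x = n := by
    have := card_extremalDigraph (n := n) (by omega : 0 < r) hs'
    simpa [Fintype.card_sigma] using this
  have h2 := sum_mul_card_outMiss hr (blowUpSizes n r s) (fun x hx => blowUpSizes_eq_one hx)
    (blowUpSizes_pos hs hs')
  rw [h1] at h2
  rw [← h2, missing, Fintype.sum_sigma]
  simp [card_outMiss_extremalDigraph]

/-- Here `f` is the inclusion of one of the two paths of `D_{2r,r,1}`; from a vertex `ρ` next to its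
start, or at its start, all vertices that replace the `j`-th one can be reached in `j + 1` steps. -/
theorem hasWalk_extremalDigraph_of_chain (hs : 1 ≤ s) (hs' : s + 2 * r ≤ n + 1)
    (f : Fin r → Fin r ⊕ Fin r)
    (hf : ∀ i j : Fin r, (j : ℕ) = i + 1 → (baseDigraph r).Adj (f i) (f j))
    (ρ : Σ v, Fin (blowUpSizes n r s v))
    (h0 : ∀ i : Fin r, (i : ℕ) = 0 → ρ.1 = f i ∨ (baseDigraph r).Adj ρ.1 (f i)) :
    ∀ (j : ℕ) (hj : j < r) (a : Fin (blowUpSizes n r s (f ⟨j, hj⟩))),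
      ∃ k ≤ j + 1, (extremalDigraph n r s).HasWalk ρ ⟨f ⟨j, hj⟩, a⟩ k := by
  intro j
  induction j with
  | zero =>
    intro hj a
    by_cases h : ρ = ⟨f ⟨0, hj⟩, a⟩
    · exact ⟨0, by omega, h ▸ HasWalk.nil ρ⟩
    · exact ⟨1, by omega, HasWalk.single ⟨h, h0 ⟨0, hj⟩ rfl⟩⟩
  | succ j ih =>
    intro hj a
    obtain ⟨k, hk, hw⟩ := ih (by omega) ⟨0, blowUpSizes_pos hs hs' _⟩
    refine ⟨k + 1, by omega, hw.trans (HasWalk.single ⟨fun h => ?_, Or.inr (hf _ _ rfl)⟩)⟩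
    have h1 := hf ⟨j, by omega⟩ ⟨j + 1, hj⟩ rfl
    have h2 : f ⟨j, by omega⟩ = f ⟨j + 1, hj⟩ := congrArg Sigma.fst h
    rw [h2] at h1
    generalize f ⟨j + 1, hj⟩ = y at h1
    rcases y with i | i <;> simp [baseDigraph] at h1

theorem exists_hasWalk_le_extremalDigraph (hr : 0 < r) (hs : 1 ≤ s) (hs' : s + 2 * r ≤ n + 1)
    (y : Σ v, Fin (blowUpSizes n r s v)) :
    ∃ k ≤ r, (extremalDigraph n r s).HasWalk
      ⟨Sum.inl ⟨0, hr⟩, ⟨0, blowUpSizes_pos hs hs' _⟩⟩ y k := by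
  obtain ⟨j | j, a⟩ := y
  · obtain ⟨k, hk, h⟩ := hasWalk_extremalDigraph_of_chain hs hs' Sum.inl
      (fun i j h => ⟨fun h' => by simp [h'] at h, by omega⟩)
      ⟨Sum.inl ⟨0, hr⟩, ⟨0, blowUpSizes_pos hs hs' _⟩⟩
      (fun i hi => Or.inl (congrArg Sum.inl (Fin.ext hi.symm))) j j.2 a
    exact ⟨k, by omega, h⟩
  · obtain ⟨k, hk, h⟩ := hasWalk_extremalDigraph_of_chain hs hs' Sum.inr
      (fun i j h => ⟨fun h' => by simp [h'] at h, by omega⟩)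
      ⟨Sum.inl ⟨0, hr⟩, ⟨0, blowUpSizes_pos hs hs' _⟩⟩
      (fun i hi => Or.inr hi) j j.2 a
    exact ⟨k, by omega, h⟩

theorem biconnected_extremalDigraph (hr : 0 < r) (hs : 1 ≤ s) (hs' : s + 2 * r ≤ n + 1) :
    (extremalDigraph n r s).Biconnected := by
  rw [biconnected_iff]
  intro x y
  obtain ⟨k, -, hk⟩ := exists_hasWalk_le_extremalDigraph hr hs hs' y
  by_cases h : x = ⟨Sum.inl ⟨0, hr⟩, ⟨0, blowUpSizes_pos hs hs' _⟩⟩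
  · exact ⟨k, h ▸ hk⟩
  · suffices hx : (extremalDigraph n r s).Adj x
        ⟨Sum.inl ⟨0, hr⟩, ⟨0, blowUpSizes_pos hs hs' _⟩⟩ from
      ⟨1 + k, (HasWalk.single hx).trans hk⟩
    refine ⟨h, ?_⟩
    obtain ⟨i | i, a⟩ := x
    · by_cases hi : (i : ℕ) = 0
      · exact Or.inl (congrArg Sum.inl (Fin.ext hi))
      · exact Or.inr ⟨fun h => hi (congrArg Fin.val h), Nat.zero_le _⟩
    · exact Or.inr rfl

/-- A function on the vertices that increases by at most `1` along every arc bounds the lengths of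
walks from below. -/
theorem HasWalk.le_add_of_potential {V : Type*} {D : Digraph V} (h : V → ℕ)
    (hh : ∀ x y, D.Adj x y → h y ≤ h x + 1) {u v : V} {k : ℕ} (p : D.HasWalk u v k) :
    h v ≤ h u + k := by
  induction p with
  | nil u => simp
  | cons ha p ih =>
    have := hh _ _ ha
    omega

theorem outradius_extremalDigraph (hr : 2 ≤ r) (hs : 1 ≤ s) (hs' : s + 2 * r ≤ n + 1) :
    (extremalDigraph n r s).outradius = r := by
  have hr0 : 0 < r := by omega
  apply le_antisymm
  · refine (iInf_le _ ⟨Sum.inl ⟨0, hr0⟩, ⟨0, blowUpSizes_pos hs hs' _⟩⟩).trans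
      (iSup_le fun y => ?_)
    obtain ⟨k, hk, h⟩ := exists_hasWalk_le_extremalDigraph hr0 hs hs' y
    exact (iInf₂_le k h).trans (by exact_mod_cast hk)
  · refine le_iInf fun x => ?_
    -- from a vertex of one path, the last vertex of the other path is far
    suffices h : ∃ (f : Fin r ⊕ Fin r → ℕ) (y : Fin r ⊕ Fin r), f x.1 = 0 ∧ f y = r ∧
        ∀ a b, (baseDigraph r).Adj a b → f b ≤ f a + 1 by
      obtain ⟨f, y, hx, hy, hf⟩ := h
      refine le_iSup_of_le (⟨y, ⟨0, blowUpSizes_pos hs hs' _⟩⟩ : Σ v, Fin (blowUpSizes n r s v)) ?_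
      refine le_iInf₂ fun k hk => ?_
      have h := hk.le_add_of_potential (fun p => f p.1) fun a b hab => by
        rcases hab.2 with h | h
        · simp [h]
        · exact hf _ _ h
      simp only [hx, hy, zero_add] at h
      exact_mod_cast h
    obtain ⟨i | i, a⟩ := x
    · refine ⟨Sum.elim (fun _ => 0) (fun j => j + 1), Sum.inr ⟨r - 1, by omega⟩, rfl, ?_, ?_⟩
      · simp; omega
      · rintro (a | a) (b | b) h <;> simp [baseDigraph] at h ⊢ <;> omega
    · refine ⟨Sum.elim (fun j => j + 1) (fun _ => 0), Sum.inl ⟨r - 1, by omega⟩, rfl, ?_, ?_⟩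
      · simp; omega
      · rintro (a | a) (b | b) h <;> simp [baseDigraph] at h ⊢ <;> omega

end extremal

/-! ### Recognizing a blow-up -/

theorem nonempty_relIso_cliqueBlowUp {V ι : Type*} [Fintype V] {D : Digraph V} {B : Digraph ι}
    {m : ι → ℕ} (φ : V → ι) (hφ : ∀ i, Nat.card {x // φ x = i} = m i)
    (hadj : ∀ x y, D.Adj x y ↔ x ≠ y ∧ (φ x = φ y ∨ B.Adj (φ x) (φ y))) :
    Nonempty (D.Adj ≃r (B.cliqueBlowUp m).Adj) := by
  classical
  let e : V ≃ Σ i, Fin (m i) := (Equiv.sigmaFiberEquiv φ).symm.trans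
    (Equiv.sigmaCongrRight fun i => Finite.equivFinOfCardEq (hφ i))
  refine ⟨⟨e, fun {x y} => ?_⟩⟩
  rw [hadj]
  simp only [cliqueBlowUp, ne_eq, e.apply_eq_iff_eq]
  exact Iff.rfl

theorem size_eq_of_relIso {V W : Type*} {D : Digraph V} {E : Digraph W} (e : D.Adj ≃r E.Adj) :
    D.size = E.size := by
  refine Set.ncard_congr (fun p _ => (e p.1, e p.2)) (fun p hp => e.map_rel_iff.2 hp) ?_ ?_
  · rintro ⟨a, b⟩ ⟨c, d⟩ - - h
    simpa using h
  · rintro ⟨a, b⟩ h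
    refine ⟨(e.symm a, e.symm b), ?_, by simp⟩
    have : E.Adj a b := h
    rw [Set.mem_ofPred_eq, ← e.map_rel_iff]
    simpa using this

/-- A digraph that is obtained from `D_{2r,r,1}` by blowing up `v_1` and `w_1` is some `D_{n,r,s}`;
the symmetry of `D_{2r,r,1}` allows to choose the smaller clique at `v_1`. -/
theorem exists_relIso_extremalDigraph {V : Type*} [Fintype V] {D : Digraph V} {n r : ℕ}
    (hr : 0 < r) (hn : Fintype.card V = n) (φ : V → Fin r ⊕ Fin r)
    (hpos : ∀ t, 1 ≤ Nat.card {x // φ x = t})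
    (hone : ∀ t, 0 < pathIndex t → Nat.card {x // φ x = t} = 1)
    (hadj : ∀ x y, D.Adj x y ↔ x ≠ y ∧ (φ x = φ y ∨ (baseDigraph r).Adj (φ x) (φ y))) :
    ∃ s : ℕ, 1 ≤ s ∧ 2 * s + 2 * r ≤ n + 2 ∧ Nonempty (D.Adj ≃r (extremalDigraph n r s).Adj) := by
  classical
  have hsum : ∀ ψ : V → Fin r ⊕ Fin r, ∑ t, Nat.card {x // ψ x = t} = n := by
    intro ψ
    rw [← hn, ← Fintype.card_congr (Equiv.sigmaFiberEquiv ψ), Fintype.card_sigma]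
    simp
  have main : ∀ ψ : V → Fin r ⊕ Fin r, (∀ t, 1 ≤ Nat.card {x // ψ x = t}) →
      (∀ t, 0 < pathIndex t → Nat.card {x // ψ x = t} = 1) →
      (∀ x y, D.Adj x y ↔ x ≠ y ∧ (ψ x = ψ y ∨ (baseDigraph r).Adj (ψ x) (ψ y))) →
      Nat.card {x // ψ x = Sum.inl ⟨0, hr⟩} ≤ Nat.card {x // ψ x = Sum.inr ⟨0, hr⟩} →
      ∃ s : ℕ, 1 ≤ s ∧ 2 * s + 2 * r ≤ n + 2 ∧
        Nonempty (D.Adj ≃r (extremalDigraph n r s).Adj) := by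
    intro ψ h1 h2 h3 h4
    have h5 := hsum ψ
    rw [sum_eq_of_eq_one hr _ h2] at h5
    refine ⟨Nat.card {x // ψ x = Sum.inl ⟨0, hr⟩}, h1 _, by omega,
      nonempty_relIso_cliqueBlowUp ψ (fun t => ?_) h3⟩
    rcases Nat.eq_zero_or_pos (pathIndex t) with ht | ht
    · rcases t with ⟨i, hi⟩ | ⟨i, hi⟩ <;>
        simp only [pathIndex, Sum.elim_inl, Sum.elim_inr] at ht <;> subst ht
      · simp [blowUpSizes]
      · simp only [blowUpSizes, if_true]
        omega
    · rw [h2 t ht, blowUpSizes_eq_one ht]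
  rcases le_total (Nat.card {x // φ x = Sum.inl ⟨0, hr⟩}) (Nat.card {x // φ x = Sum.inr ⟨0, hr⟩})
    with h | h
  · exact main φ hpos hone hadj h
  · have hsw : ∀ x t, (φ x).swap = t ↔ φ x = t.swap := fun x t =>
      ⟨fun h => by rw [← h, Sum.swap_swap], fun h => by rw [h, Sum.swap_swap]⟩
    refine main (fun x => (φ x).swap) (fun t => ?_) (fun t ht => ?_) (fun x y => ?_) ?_
    · simpa only [hsw] using hpos t.swap
    · simp only [hsw]
      refine hone _ ?_
      rcases t with t | t <;> exact ht
    · rw [hadj, baseDigraph_adj_swap, hsw, Sum.swap_swap]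
    · simpa only [hsw, Sum.swap_inl, Sum.swap_inr] using h

/-! ### Digraphs with a skeleton -/

section pathPairs

variable {V : Type*} {D : Digraph V}

section skeleton

variable {r : ℕ} {v w : ℕ → V}

/-- The vertices of the two paths of a skeleton, as images of the vertices of `D_{2r,r,1}`. -/
def skeletonMap (r : ℕ) (v w : ℕ → V) : Fin r ⊕ Fin r → V :=
  Sum.elim (fun i => v i) (fun i => w i)

theorem Skeleton.injective (h : D.Skeleton r v w) : Function.Injective (skeletonMap r v w) := by
  rintro (i | i) (j | j) hij <;> simp only [skeletonMap, Sum.elim_inl, Sum.elim_inr] at hij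
  · have h1 := h.level_v i i.2
    rw [hij, h.level_v j j.2] at h1
    rw [Fin.ext h1]
  · exact absurd hij (h.ne i i.2 j j.2)
  · exact absurd hij.symm (h.ne j j.2 i i.2)
  · have h1 := h.level_w i i.2
    rw [hij, h.level_w j j.2] at h1
    rw [Fin.ext (by omega : (j : ℕ) = i)]

/-- A vertex of the second path other than the last one is close to the end of this path, so its far
vertex is the last vertex of the first path. -/
theorem Skeleton.far_v_of_w (h : D.Skeleton r v w) (hD : D.Biconnected) {k : ℕ} (hk : k + 2 ≤ r) :
    r ≤ D.ndist (w k) (v (r - 1)) := by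
  have h1 := hD.ndist_le_of_chain h.adj_w (by omega : k ≤ r - 1) le_rfl
  have h2 := hD.ndist_le_of_chain h.adj_w (by omega : k ≤ r - 2) (by omega)
  rcases h.far (w k) with h3 | h3 | h3 <;> omega

section pattern

variable [DecidableEq V]

/-- The set of out-non-neighbours that the vertex of `D_{2r,r,1}` named `t` has, transported to the
skeleton. -/
noncomputable def pattern (r : ℕ) (v w : ℕ → V) (t : Fin r ⊕ Fin r) : Finset V :=
  ((baseDigraph r).outMiss t).image (skeletonMap r v w)

theorem pattern_inl_subset {i : Fin r} {S : Finset V} :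
    pattern r v w (Sum.inl i) ⊆ S ↔
      (∀ j < r, (i : ℕ) + 2 ≤ j → v j ∈ S) ∧ ∀ j < r, 1 ≤ j → w j ∈ S := by
  simp only [pattern, Finset.image_subset_iff, Sum.forall, inl_mem_outMiss_inl,
    inr_mem_outMiss_inl, skeletonMap, Sum.elim_inl, Sum.elim_inr, Fin.forall_iff]

theorem pattern_inr_subset {i : Fin r} {S : Finset V} :
    pattern r v w (Sum.inr i) ⊆ S ↔
      (∀ j < r, 1 ≤ j → v j ∈ S) ∧ ∀ j < r, (i : ℕ) + 2 ≤ j → w j ∈ S := by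
  simp only [pattern, Finset.image_subset_iff, Sum.forall, inl_mem_outMiss_inr,
    inr_mem_outMiss_inr, skeletonMap, Sum.elim_inl, Sum.elim_inr, Fin.forall_iff]

theorem Skeleton.card_pattern (h : D.Skeleton r v w) (t : Fin r ⊕ Fin r) :
    (pattern r v w t).card = ((baseDigraph r).outMiss t).card :=
  Finset.card_image_of_injective _ h.injective

end pattern

variable [Fintype V]

theorem Skeleton.mem_outMiss_of_far_v (h : D.Skeleton r v w) (hD : D.Biconnected) {x : V}
    (hx : r ≤ D.ndist x (v (r - 1))) {j : ℕ} (hj : j < r) (hj1 : 1 ≤ j) : v j ∈ D.outMiss x := by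
  rw [hD.mem_outMiss_iff]
  have h1 := hD.ndist_triangle x (v j) (v (r - 1))
  have h2 := hD.ndist_le_of_chain h.adj_v (by omega : j ≤ r - 1) le_rfl
  omega

theorem Skeleton.mem_outMiss_of_far_w (h : D.Skeleton r v w) (hD : D.Biconnected) {x : V}
    (hx : r ≤ D.ndist x (w (r - 1))) {j : ℕ} (hj : j < r) (hj1 : 1 ≤ j) : w j ∈ D.outMiss x := by
  rw [hD.mem_outMiss_iff]
  have h1 := hD.ndist_triangle x (w j) (w (r - 1))
  have h2 := hD.ndist_le_of_chain h.adj_w (by omega : j ≤ r - 1) le_rfl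
  omega

theorem Skeleton.mem_outMiss_of_far_w' (h : D.Skeleton r v w) (hD : D.Biconnected) {x : V}
    (hx : r ≤ D.ndist x (w (r - 2))) {j : ℕ} (hj : j + 2 ≤ r) : w j ∈ D.outMiss x := by
  rw [hD.mem_outMiss_iff]
  have h1 := hD.ndist_triangle x (w j) (w (r - 2))
  have h2 := hD.ndist_le_of_chain h.adj_w (by omega : j ≤ r - 2) (by omega)
  omega

theorem mem_outMiss_of_level (hD : D.Biconnected) {b x y : V}
    (h : D.ndist b x + 2 ≤ D.ndist b y) : y ∈ D.outMiss x := by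
  rw [hD.mem_outMiss_iff]
  have := hD.ndist_triangle b x y
  omega

variable [DecidableEq V]

theorem Skeleton.pattern_subset_w (h : D.Skeleton r v w) (hD : D.Biconnected) {k : Fin r}
    (hk : r ≤ D.ndist (w k) (v (r - 1))) : pattern r v w (Sum.inr k) ⊆ D.outMiss (w k) := by
  rw [pattern_inr_subset]
  refine ⟨fun j hj hj1 => h.mem_outMiss_of_far_v hD hk hj hj1, fun j hj hj1 => ?_⟩
  refine mem_outMiss_of_level hD (b := v 0) ?_
  rw [h.level_w k k.2, h.level_w j hj]
  omega

/-- The last vertex of the second path may be far from `w (r - 2)` rather than from `v (r - 1)`;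
then it misses too many arcs, as the far vertex of `w (r - 2)` must be far from it, too. -/
theorem Skeleton.last_w (h : D.Skeleton r v w) (hD : D.Biconnected) (hr : 4 ≤ r) (k : Fin r)
    (hk : (k : ℕ) = r - 1) : pattern r v w (Sum.inr k) ⊆ D.outMiss (w k) ∨
      (pattern r v w (Sum.inr k)).card < (D.outMiss (w k)).card := by
  rcases h.far (w k) with h1 | h1 | h1
  · exact Or.inl (h.pattern_subset_w hD h1)
  · right
    -- `w 0, …, w (r - 2)` and `v (r - 1)` are missing
    have h2 := h.far_v_of_w hD (k := r - 2) (by omega)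
    have h3 := hD.ndist_le_of_adj (h.adj_w (r - 2) (by omega)) (v (r - 1))
    rw [show r - 2 + 1 = k by omega] at h3
    have h4 : insert (v (r - 1)) ((Finset.range (r - 1)).image w) ⊆ D.outMiss (w k) := by
      intro x hx
      rcases Finset.mem_insert.1 hx with rfl | hx
      · rw [hD.mem_outMiss_iff]
        omega
      · obtain ⟨j, hj, rfl⟩ := Finset.mem_image.1 hx
        rw [Finset.mem_range] at hj
        exact h.mem_outMiss_of_far_w' hD h1 (by omega)
    have h5 := Finset.card_le_card h4
    rw [Finset.card_insert_of_notMem, Finset.card_image_of_injOn, Finset.card_range] at h5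
    · rw [h.card_pattern, card_outMiss_baseDigraph]
      simp only [pathIndex, Sum.elim_inr]
      omega
    · intro i hi j hj hij
      simp only [Finset.coe_range, Set.mem_Iio] at hi hj
      have h6 := h.level_w i (by omega)
      have h7 : w i = w j := hij
      rw [h7, h.level_w j (by omega)] at h6
      omega
    · intro hx
      obtain ⟨j, hj, hjv⟩ := Finset.mem_image.1 hx
      rw [Finset.mem_range] at hj
      exact h.ne (r - 1) (by omega) j (by omega) hjv.symm
  · rw [hk] at h1
    simp at h1
    omega

/-- A vertex `v k` may be far from `w (r - 2)` rather than from `w (r - 1)`. Then it may have an arc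
to `w (r - 1)`, outside its pattern, but it misses the arc to `w 0`. -/
theorem Skeleton.row_v (h : D.Skeleton r v w) (hD : D.Biconnected) (hr : 4 ≤ r) (k : Fin r) :
    (pattern r v w (Sum.inl k)).card ≤ (D.outMiss (v k)).card ∧
      (pattern r v w (Sum.inl k) ⊆ D.outMiss (v k) ∨
        (D.Adj (v k) (w (r - 1)) ∧ r ≤ D.ndist (v k) (w (r - 2)))) := by
  have hlev : ∀ j < r, (k : ℕ) + 2 ≤ j → v j ∈ D.outMiss (v k) := by
    intro j hj hkj
    refine mem_outMiss_of_level hD (b := v 0) ?_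
    rw [h.level_v k k.2, h.level_v j hj]
    exact hkj
  have key : pattern r v w (Sum.inl k) ⊆ D.outMiss (v k) ∨ r ≤ D.ndist (v k) (w (r - 2)) := by
    by_cases hk0 : (k : ℕ) = 0
    · refine Or.inl (pattern_inl_subset.2 ⟨hlev, fun j hj hj1 => ?_⟩)
      refine mem_outMiss_of_level hD (b := v 0) ?_
      rw [hk0, ndist_self, h.level_w j hj]
      omega
    · have h1 := hD.ndist_le_of_chain h.adj_v (by omega : (k : ℕ) ≤ r - 1) le_rfl
      rcases h.far (v k) with h2 | h2 | h2
      · omega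
      · exact Or.inr h2
      · exact Or.inl (pattern_inl_subset.2
          ⟨hlev, fun j hj hj1 => h.mem_outMiss_of_far_w hD h2 hj hj1⟩)
  rcases key with h1 | h1
  · exact ⟨Finset.card_le_card h1, Or.inl h1⟩
  constructor
  · have h2 : (Finset.range (r - 1)).image w ∪ (Finset.Ico (k + 2 : ℕ) r).image v ⊆
        D.outMiss (v k) := by
      intro x hx
      rcases Finset.mem_union.1 hx with hx | hx <;>
        obtain ⟨j, hj, rfl⟩ := Finset.mem_image.1 hx
      · rw [Finset.mem_range] at hj
        exact h.mem_outMiss_of_far_w' hD h1 (by omega)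
      · rw [Finset.mem_Ico] at hj
        exact hlev j hj.2 hj.1
    have h3 := Finset.card_le_card h2
    rw [Finset.card_union_of_disjoint, Finset.card_image_of_injOn, Finset.card_image_of_injOn,
      Finset.card_range, Nat.card_Ico] at h3
    · rw [h.card_pattern, card_outMiss_baseDigraph]
      exact h3
    · intro i hi j hj hij
      simp only [Finset.coe_Ico, Set.mem_Ico] at hi hj
      have h6 := h.level_v i (by omega)
      have h7 : v i = v j := hij
      rw [h7, h.level_v j (by omega)] at h6
      omega
    · intro i hi j hj hij
      simp only [Finset.coe_range, Set.mem_Iio] at hi hj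
      have h6 := h.level_w i (by omega)
      have h7 : w i = w j := hij
      rw [h7, h.level_w j (by omega)] at h6
      omega
    · rw [Finset.disjoint_left]
      intro x hx hy
      obtain ⟨i, hi, rfl⟩ := Finset.mem_image.1 hx
      obtain ⟨j, hj, hij⟩ := Finset.mem_image.1 hy
      rw [Finset.mem_range] at hi
      rw [Finset.mem_Ico] at hj
      exact h.ne j hj.2 i (by omega) hij
  · by_cases h2 : D.Adj (v k) (w (r - 1))
    · exact Or.inr ⟨h2, h1⟩
    · refine Or.inl (pattern_inl_subset.2 ⟨hlev, fun j hj hj1 => ?_⟩)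
      by_cases h3 : j = r - 1
      · rw [h3, mem_outMiss]
        exact ⟨h.ne k k.2 (r - 1) (by omega), h2⟩
      · exact h.mem_outMiss_of_far_w' hD h1 (by omega)

/-- A vertex `u` outside the skeleton misses the arcs that a copy of `v 0` or of `w 0` misses, with
the exception of the arc to `v 2` in one case. -/
theorem Skeleton.row_outside (h : D.Skeleton r v w) (hD : D.Biconnected) (hr : 4 ≤ r) {u : V}
    (hu : u ∉ Set.range (skeletonMap r v w)) :
    pattern r v w (Sum.inr ⟨0, by omega⟩) ⊆ D.outMiss u ∨
      pattern r v w (Sum.inl ⟨0, by omega⟩) ⊆ D.outMiss u ∨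
      (D.Adj u (v 2) ∧ (pattern r v w (Sum.inl ⟨0, by omega⟩)).erase (v 2) ⊆ D.outMiss u) := by
  have hlev : D.ndist (v 0) u ≤ 1 := by
    by_contra! h1
    rcases h.cover u h1 with ⟨i, hi, rfl⟩ | ⟨i, hi, rfl⟩
    · exact hu ⟨Sum.inl ⟨i, hi⟩, rfl⟩
    · exact hu ⟨Sum.inr ⟨i, hi⟩, rfl⟩
  have hlv : ∀ j < r, 3 ≤ j → v j ∈ D.outMiss u := fun j hj hj3 =>
    mem_outMiss_of_level hD (b := v 0) (by rw [h.level_v j hj]; omega)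
  have hlw : ∀ j < r, 2 ≤ j → w j ∈ D.outMiss u := fun j hj hj3 =>
    mem_outMiss_of_level hD (b := v 0) (by rw [h.level_w j hj]; omega)
  by_cases h1 : r ≤ D.ndist u (v (r - 1))
  · refine Or.inl (pattern_inr_subset.2 ⟨fun j hj hj1 => h.mem_outMiss_of_far_v hD h1 hj hj1, ?_⟩)
    intro j hj hj1
    exact hlw j hj (by simpa using hj1)
  have hw : ∀ j < r, 1 ≤ j → w j ∈ D.outMiss u := by
    intro j hj hj1
    rcases (h.far u).resolve_left h1 with h2 | h2
    · by_cases h3 : j = r - 1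
      · exact hlw j hj (by omega)
      · exact h.mem_outMiss_of_far_w' hD h2 (by omega)
    · exact h.mem_outMiss_of_far_w hD h2 hj hj1
  right
  by_cases h2 : D.Adj u (v 2)
  · refine Or.inr ⟨h2, ?_⟩
    rw [← Finset.subset_insert_iff, pattern_inl_subset]
    refine ⟨fun j hj hj1 => ?_, fun j hj hj1 => Finset.mem_insert_of_mem (hw j hj hj1)⟩
    by_cases h3 : j = 2
    · rw [h3]
      exact Finset.mem_insert_self _ _
    · exact Finset.mem_insert_of_mem (hlv j hj (by simp at hj1; omega))
  · refine Or.inl (pattern_inl_subset.2 ⟨fun j hj hj1 => ?_, hw⟩)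
    by_cases h3 : j = 2
    · rw [h3, mem_outMiss]
      refine ⟨?_, h2⟩
      rintro rfl
      exact hu ⟨Sum.inl ⟨2, by omega⟩, rfl⟩
    · exact hlv j hj (by simp at hj1; omega)

/-- The two rows `w 0` and `w 1` miss, besides their patterns, the arcs to all vertices with an
arc to `v 2`. -/
theorem Skeleton.row_w_add (h : D.Skeleton r v w) (hD : D.Biconnected) (hr : 4 ≤ r) (k : Fin r)
    (hk : (k : ℕ) + 2 ≤ r) (B : Finset V)
    (hB : ∀ u ∈ B, u ∉ Set.range (skeletonMap r v w) ∧ D.Adj u (v 2)) :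
    (pattern r v w (Sum.inr k)).card + B.card ≤ (D.outMiss (w k)).card := by
  have h1 := h.far_v_of_w hD hk
  rw [← Finset.card_union_of_disjoint]
  · refine Finset.card_le_card (Finset.union_subset (h.pattern_subset_w hD h1) fun u hu => ?_)
    rw [hD.mem_outMiss_iff]
    have h2 := hD.ndist_triangle (w k) u (v (r - 1))
    have h3 := hD.ndist_le_of_adj (hB u hu).2 (v (r - 1))
    have h4 := hD.ndist_le_of_chain h.adj_v (by omega : 2 ≤ r - 1) le_rfl
    omega
  · rw [Finset.disjoint_left]
    intro u hu huB
    obtain ⟨t, -, rfl⟩ := Finset.mem_image.1 hu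
    exact (hB _ huB).1 ⟨t, rfl⟩

/-- A digraph with a skeleton misses at least as many arcs as `D_{n,r,1}`, with equality only for a
blow-up of `D_{2r,r,1}` at the first vertices of the two paths. -/
theorem Skeleton.missing_le (h : D.Skeleton r v w) (hD : D.Biconnected) (hr : 4 ≤ r) :
    (2 * r - 3) * (Fintype.card V - 2 * r) + (r - 1) * (3 * r - 2) ≤ D.missing ∧
      (D.missing = (2 * r - 3) * (Fintype.card V - 2 * r) + (r - 1) * (3 * r - 2) →
        ∀ x, ∃ t, (x = skeletonMap r v w t ∨
            (x ∉ Set.range (skeletonMap r v w) ∧ pathIndex t = 0)) ∧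
          D.outMiss x = pattern r v w t) := by
  classical
  set σ := skeletonMap r v w with hσ
  have hr0 : 0 < r := by omega
  let φ : V → Fin r ⊕ Fin r := Function.extend σ id fun _ => Sum.inl ⟨0, hr0⟩
  have hφσ : ∀ t, φ (σ t) = t := fun t => h.injective.extend_apply _ _ t
  have hφ0 : ∀ x, x ∉ Set.range σ → φ x = Sum.inl ⟨0, hr0⟩ := fun x hx =>
    Function.extend_apply' _ _ x hx
  let c : V → ℕ := fun x => (pattern r v w (φ x)).card
  have hc0 : ∀ x, x ∉ Set.range σ → c x = 2 * r - 3 := by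
    intro x hx
    simp only [c]
    rw [hφ0 x hx, h.card_pattern, card_outMiss_baseDigraph]
    simp only [pathIndex, Sum.elim_inl]
    omega
  have hcr : (pattern r v w (Sum.inr ⟨0, hr0⟩)).card = 2 * r - 3 := by
    rw [h.card_pattern, card_outMiss_baseDigraph]
    simp only [pathIndex, Sum.elim_inr]
    omega
  have hcl : (pattern r v w (Sum.inl ⟨0, hr0⟩)).card = 2 * r - 3 := by
    rw [h.card_pattern, card_outMiss_baseDigraph]
    simp only [pathIndex, Sum.elim_inl]
    omega
  have hcsum : ∑ x, c x = (2 * r - 3) * (Fintype.card V - 2 * r) + (r - 1) * (3 * r - 2) := by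
    rw [← Finset.sum_compl_add_sum (Finset.univ.image σ) c,
      Finset.sum_image h.injective.injOn, ← missing_baseDigraph (by omega), missing]
    congr 1
    · rw [Finset.sum_congr rfl fun x hx => hc0 x ?_, Finset.sum_const, Finset.card_compl,
        Finset.card_image_of_injective _ h.injective, smul_eq_mul, mul_comm]
      · simp [two_mul]
      · simpa using hx
    · exact Finset.sum_congr rfl fun t _ => by simp only [c]; rw [hφσ, h.card_pattern]
  -- the only vertices that may miss fewer arcs than a copy of `v 0`
  let B : Finset V := Finset.univ.filter fun u => u ∉ Set.range σ ∧ D.Adj u (v 2)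
  have hB : ∀ u ∈ B, u ∉ Set.range σ ∧ D.Adj u (v 2) := fun u hu => (Finset.mem_filter.1 hu).2
  have hrow : ∀ x, c x + ((if x = w 0 then B.card else 0) + (if x = w 1 then B.card else 0)) ≤
      (D.outMiss x).card + (if x ∈ B then 1 else 0) := by
    intro x
    have hw01 : w 0 ≠ w 1 := fun h01 => by
      have := h.injective (a₁ := Sum.inr ⟨0, hr0⟩) (a₂ := Sum.inr ⟨1, by omega⟩) h01
      simp at this
    by_cases hx : x ∈ Set.range σ
    · obtain ⟨t, rfl⟩ := hx
      have hcx : c (σ t) = (pattern r v w t).card := by simp only [c]; rw [hφσ]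
      rw [hcx]
      rcases t with k | k
      · have h1 := (h.row_v hD hr k).1
        have h2 : σ (Sum.inl k) ≠ w 0 := h.ne k k.2 0 hr0
        have h3 : σ (Sum.inl k) ≠ w 1 := h.ne k k.2 1 (by omega)
        rw [if_neg h2, if_neg h3]
        exact h1.trans (Nat.le_add_right _ _)
      · have hk : ∀ j < r, σ (Sum.inr k) = w j ↔ (k : ℕ) = j := by
          intro j hj
          refine ⟨fun h1 => ?_, fun h1 => by rw [← h1]; rfl⟩
          have := h.injective (a₁ := Sum.inr k) (a₂ := Sum.inr ⟨j, hj⟩) h1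
          simpa [Fin.ext_iff] using this
        have h0 : σ (Sum.inr k) = w k := rfl
        rw [if_congr (hk 0 hr0) rfl rfl, if_congr (hk 1 (by omega)) rfl rfl, h0]
        by_cases hk2 : (k : ℕ) + 2 ≤ r
        · have h1 := h.row_w_add hD hr k hk2 B hB
          split_ifs <;> omega
        · have h1 : (pattern r v w (Sum.inr k)).card ≤ (D.outMiss (w k)).card := by
            rcases h.last_w hD hr k (by omega) with h1 | h1
            · exact Finset.card_le_card h1
            · exact h1.le
          rw [if_neg (by omega), if_neg (by omega)]
          omega
    · have h2 : x ≠ w 0 := fun h1 => hx ⟨Sum.inr ⟨0, hr0⟩, h1.symm⟩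
      have h3 : x ≠ w 1 := fun h1 => hx ⟨Sum.inr ⟨1, by omega⟩, h1.symm⟩
      rw [if_neg h2, if_neg h3, hc0 x hx]
      rcases h.row_outside hD hr hx with h1 | h1 | ⟨h4, h1⟩
      · have := Finset.card_le_card h1
        omega
      · have := Finset.card_le_card h1
        omega
      · have h5 := Finset.card_le_card h1
        have h6 := Finset.pred_card_le_card_erase (s := pattern r v w (Sum.inl ⟨0, hr0⟩))
          (a := v 2)
        rw [if_pos (Finset.mem_filter.2 ⟨Finset.mem_univ x, hx, h4⟩)]
        omega
  have hsumL : ∑ x, (c x + ((if x = w 0 then B.card else 0) + (if x = w 1 then B.card else 0))) =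
      ∑ x, c x + 2 * B.card := by
    simp [Finset.sum_add_distrib, two_mul]
  have hsumR : ∑ x, ((D.outMiss x).card + (if x ∈ B then 1 else 0)) = D.missing + B.card := by
    simp [Finset.sum_add_distrib, missing]
  have hle := Finset.sum_le_sum fun x (_ : x ∈ Finset.univ) => hrow x
  rw [hsumL, hsumR, hcsum] at hle
  refine ⟨by omega, fun heq => ?_⟩
  have hB0 : B = ∅ := Finset.card_eq_zero.1 (by omega)
  have hrow' : ∀ x, c x ≤ (D.outMiss x).card := fun x => by simpa [hB0] using hrow x
  have hceq : ∀ x, c x = (D.outMiss x).card := by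
    have h1 : ∑ x, c x = ∑ x, (D.outMiss x).card := hcsum.trans heq.symm
    exact fun x => (Finset.sum_eq_sum_iff_of_le fun x _ => hrow' x).1 h1 x (Finset.mem_univ x)
  have hcσ : ∀ t, (D.outMiss (σ t)).card = (pattern r v w t).card := fun t => by
    rw [← hceq]; simp only [c]; rw [hφσ]
  have hout : ∀ {x t}, pattern r v w t ⊆ D.outMiss x →
      (D.outMiss x).card = (pattern r v w t).card → D.outMiss x = pattern r v w t :=
    fun h1 h2 => (Finset.eq_of_subset_of_card_le h1 h2.le).symm
  have hwk : ∀ k : Fin r, pattern r v w (Sum.inr k) ⊆ D.outMiss (w k) := by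
    intro k
    by_cases hk : (k : ℕ) + 2 ≤ r
    · exact h.pattern_subset_w hD (h.far_v_of_w hD hk)
    · exact (h.last_w hD hr k (by omega)).resolve_right fun h1 => h1.ne' (hcσ (Sum.inr k))
  -- this excludes the second alternative in `Skeleton.row_v`
  have hback : D.Adj (w (r - 1)) (w (r - 2)) := by
    have h1 := hout (hwk ⟨r - 1, by omega⟩) (hcσ (Sum.inr ⟨r - 1, by omega⟩))
    have h2 : w (r - 2) ∉ D.outMiss (w (r - 1)) := by
      intro hmem
      rw [h1] at hmem
      obtain ⟨t, ht, htw⟩ := Finset.mem_image.1 hmem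
      rw [h.injective (a₁ := t) (a₂ := Sum.inr ⟨r - 2, by omega⟩) htw, inr_mem_outMiss_inr] at ht
      simp at ht
      omega
    rw [mem_outMiss] at h2
    by_contra h3
    refine h2 ⟨fun h4 => ?_, h3⟩
    have := h.injective (a₁ := Sum.inr ⟨r - 1, by omega⟩) (a₂ := Sum.inr ⟨r - 2, by omega⟩) h4
    simp at this
    omega
  intro x
  by_cases hx : x ∈ Set.range σ
  · obtain ⟨t, rfl⟩ := hx
    refine ⟨t, Or.inl rfl, hout ?_ (hcσ t)⟩
    rcases t with k | k
    · refine (h.row_v hD hr k).2.resolve_right fun ⟨h1, h2⟩ => ?_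
      have h3 := hD.ndist_le_of_adj h1 (w (r - 2))
      have h4 := ndist_le_one hback
      omega
    · exact hwk k
  · have h1 := hceq x
    rw [hc0 x hx] at h1
    rcases h.row_outside hD hr hx with h2 | h2 | ⟨h2, -⟩
    · exact ⟨Sum.inr ⟨0, hr0⟩, Or.inr ⟨hx, rfl⟩, hout h2 (h1.symm.trans hcr.symm)⟩
    · exact ⟨Sum.inl ⟨0, hr0⟩, Or.inr ⟨hx, rfl⟩, hout h2 (h1.symm.trans hcl.symm)⟩
    · have h3 : x ∈ B := Finset.mem_filter.2 ⟨Finset.mem_univ x, hx, h2⟩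
      rw [hB0] at h3
      simp at h3

theorem Skeleton.exists_relIso (h : D.Skeleton r v w) (hD : D.Biconnected) (hl : D.Loopless)
    (hr : 4 ≤ r)
    (heq : D.missing = (2 * r - 3) * (Fintype.card V - 2 * r) + (r - 1) * (3 * r - 2)) :
    ∃ s : ℕ, 1 ≤ s ∧ 2 * s + 2 * r ≤ Fintype.card V + 2 ∧
      Nonempty (D.Adj ≃r (extremalDigraph (Fintype.card V) r s).Adj) := by
  choose φ hφ hout using (h.missing_le hD hr).2 heq
  have hφσ : ∀ t, φ (skeletonMap r v w t) = t := by
    intro t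
    rcases hφ (skeletonMap r v w t) with h1 | h1
    · exact (h.injective h1).symm
    · exact absurd ⟨t, rfl⟩ h1.1
  refine exists_relIso_extremalDigraph (by omega) rfl φ (fun t => ?_) (fun t ht => ?_)
    fun x y => ?_
  · have : Nonempty {x // φ x = t} := ⟨⟨_, hφσ t⟩⟩
    exact Nat.card_pos
  · rw [Nat.card_eq_one_iff_unique]
    refine ⟨⟨fun a b => Subtype.ext ?_⟩, ⟨⟨_, hφσ t⟩⟩⟩
    have key : ∀ x, φ x = t → x = skeletonMap r v w t := by
      intro x hx
      have h1 := hφ x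
      rw [hx] at h1
      exact h1.resolve_right fun h2 => ht.ne' h2.2
    rw [key a a.2, key b b.2]
  · by_cases hxy : x = y
    · subst hxy
      simp [hl x]
    have h1 : D.Adj x y ↔ y ∉ D.outMiss x := by simp [hxy]
    have h2 : φ x = φ y ∨ (baseDigraph r).Adj (φ x) (φ y) ↔
        φ y ∉ (baseDigraph r).outMiss (φ x) := by
      rw [mem_outMiss]
      tauto
    rw [h1, h2, hout x, and_iff_right hxy, not_iff_not, pattern, Finset.mem_image]
    constructor
    · rintro ⟨t, ht, rfl⟩
      rwa [hφσ]
    · intro hy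
      refine ⟨φ y, hy, ?_⟩
      rcases hφ y with h3 | h3
      · exact h3.symm
      · have := pathIndex_pos_of_mem_outMiss hy
        omega

end skeleton

end pathPairs

end Digraph

theorem mainTheorem2 (r : ℕ) (hr : 4 ≤ r) :
    ∃ n₁ : ℕ, ∀ n : ℕ, n₁ < n →
      -- the size of `D_{n,r,1}`
      (((extremalDigraph n r 1).size : ℤ) = ((n : ℤ) - ((r : ℤ) - 1)) ^ 2 + ((r : ℤ) - 3)) ∧
      -- the digraphs `D_{n,r,s}` are admissible
      (∀ s : ℕ, 1 ≤ s → (s : ℚ) ≤ ((n : ℚ) - 2 * r + 2) / 2 →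
        Fintype.card (Σ v, Fin (blowUpSizes n r s v)) = n ∧
        (extremalDigraph n r s).Loopless ∧
        (extremalDigraph n r s).Biconnected ∧
        (extremalDigraph n r s).outradius = r) ∧
      -- the bound and its equality case
      (∀ (V : Type*) [Fintype V] (D : Digraph V), D.Loopless → Fintype.card V = n →
        D.Biconnected → D.outradius = r →
          D.size ≤ (extremalDigraph n r 1).size ∧
          (D.size = (extremalDigraph n r 1).size ↔
            ∃ s : ℕ, 1 ≤ s ∧ (s : ℚ) ≤ ((n : ℚ) - 2 * r + 2) / 2 ∧
              Nonempty (D.Adj ≃r (extremalDigraph n r s).Adj))) := by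
  obtain ⟨t, ht⟩ : ∃ t, t = 2 * r - 3 := ⟨_, rfl⟩
  have ht0 : 0 < t := by omega
  obtain ⟨K, hK⟩ : ∃ K, K + 1 = 4 * (t + 1) * t :=
    ⟨4 * (t + 1) * t - 1, Nat.sub_add_cancel (Nat.mul_pos (by omega) ht0)⟩
  refine ⟨2 * (t + 1) * (2 ^ t * (K + 1)) + 2 * r, fun n hn => ?_⟩
  have hsize : ∀ s, 1 ≤ s → s + 2 * r ≤ n + 1 →
      (extremalDigraph n r s).size + ((2 * r - 3) * (n - 2 * r) + (r - 1) * (3 * r - 2)) =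
        n * (n - 1) := by
    intro s hs hs'
    have h := Digraph.size_add_missing (Digraph.loopless_extremalDigraph (n := n) (r := r) (s := s))
    rwa [Digraph.missing_extremalDigraph (by omega) hs hs',
      Digraph.card_extremalDigraph (by omega) hs'] at h
  have hs_iff : ∀ s : ℕ, (s : ℚ) ≤ ((n : ℚ) - 2 * r + 2) / 2 ↔ 2 * s + 2 * r ≤ n + 2 := by
    intro s
    rw [le_div_iff₀ (by norm_num)]
    constructor
    · intro h
      have : (2 * s + 2 * r : ℚ) ≤ n + 2 := by linarith
      exact_mod_cast this
    · intro h
      have : (2 * s + 2 * r : ℚ) ≤ n + 2 := by exact_mod_cast h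
      linarith
  have hsize1 := hsize 1 le_rfl (by omega)
  refine ⟨?_, ?_, ?_⟩
  · obtain ⟨q, rfl⟩ := Nat.exists_eq_add_of_le' hr
    obtain ⟨m, rfl⟩ := Nat.exists_eq_add_of_le' (show 2 * (q + 4) ≤ n by omega)
    simp only [show 2 * (q + 4) - 3 = 2 * q + 5 by omega, Nat.add_sub_cancel,
      show q + 4 - 1 = q + 3 by omega, show 3 * (q + 4) - 2 = 3 * q + 10 by omega,
      show m + 2 * (q + 4) - 1 = m + 2 * q + 7 by omega] at hsize1
    zify at hsize1
    push_cast
    linarith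
  · intro s hs hs'
    rw [hs_iff] at hs'
    exact ⟨Digraph.card_extremalDigraph (by omega) (by omega), Digraph.loopless_extremalDigraph,
      Digraph.biconnected_extremalDigraph (by omega) hs (by omega),
      Digraph.outradius_extremalDigraph (by omega) hs (by omega)⟩
  · intro V _ D hl hV hD hrad
    classical
    have hDsize := Digraph.size_add_missing hl
    rw [hV] at hDsize
    have main : (2 * r - 3) * (n - 2 * r) + (r - 1) * (3 * r - 2) ≤ D.missing ∧
        (D.missing = (2 * r - 3) * (n - 2 * r) + (r - 1) * (3 * r - 2) →
          ∃ s : ℕ, 1 ≤ s ∧ 2 * s + 2 * r ≤ n + 2 ∧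
            Nonempty (D.Adj ≃r (extremalDigraph n r s).Adj)) := by
      by_cases hM : D.missing ≤ t * n
      · subst hV
        obtain ⟨v, w, h⟩ := hD.exists_skeleton_of_missing_le hr ht hK (hD.exists_le_ndist hrad) hM
          (by omega)
        exact ⟨(h.missing_le hD hr).1, h.exists_relIso hD hl hr⟩
      · have hlt : (2 * r - 3) * (n - 2 * r) + (r - 1) * (3 * r - 2) < D.missing := by
          refine lt_of_le_of_lt ?_ (not_le.1 hM)
          rw [ht]
          obtain ⟨q, rfl⟩ := Nat.exists_eq_add_of_le' hr
          obtain ⟨m, rfl⟩ := Nat.exists_eq_add_of_le' (show 2 * (q + 4) ≤ n by omega)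
          simp only [show 2 * (q + 4) - 3 = 2 * q + 5 by omega, Nat.add_sub_cancel,
            show q + 4 - 1 = q + 3 by omega, show 3 * (q + 4) - 2 = 3 * q + 10 by omega]
          nlinarith
        exact ⟨hlt.le, fun h => absurd h hlt.ne'⟩
    refine ⟨by omega, fun h => ?_, ?_⟩
    · obtain ⟨s, h1, h2, h3⟩ := main.2 (by omega)
      exact ⟨s, h1, (hs_iff s).2 h2, h3⟩
    · rintro ⟨s, h1, h2, ⟨e⟩⟩
      rw [hs_iff] at h2
      have h3 := hsize s h1 (by omega)
      rw [Digraph.size_eq_of_relIso e]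
      omega
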